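/- Let $\mathfrak g$ be a finite-dimensional complex Lie algebra, let $G$ be a connected and simply connected complex Lie group with Lie algebra $\mathfrak g$, and let $\tau$ be a representation of $\mathfrak g$ on a finite-dimensional complex vector space $V_\tau$; write $\tau$ also for the representation of $G$ on $V_\tau$ to which it gives rise, that is, the holomorphic representation of $G$ whose differential at the identity is $\tau$. For $t\in\mathbb C$ let $S(\mathfrak g)$ be the symmetric algebra of $\mathfrak g$ and let $$U_t(\mathfrak g)=T(\mathfrak g)/\bigl(X\otimes Y-Y\otimes X-t[X,Y] : X,Y\in\mathfrak g\bigr),$$ where $T(\mathfrak g)$ is the tensor algebra. The group $G$ acts on $\mathrm{End}_{\mathbb C}V_\tau$ by $g\cdot A=\tau(g)\circ A\circ\tau(g)^{-1}$, on $S(\mathfrak g)$ and $U_t(\mathfrak g)$ by the algebra automorphisms extending the adjoint action on $\mathfrak g$, and diagonally on $\mathrm{End}_{\mathbb C}V_\tau\otimes_{\mathbb C}S(\mathfrak g)$ and $\mathrm{End}_{\mathbb C}V_\tau\otimes_{\mathbb C}U_t(\mathfrak g)$. Let $$\mathcal C_\tau(\mathfrak g)=(\mathrm{End}_{\mathbb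 C}V_\tau\otimes_{\mathbb C} S(\mathfrak g))^G,\qquad \mathcal Q^t_\tau(\mathfrak g)=(\mathrm{End}_{\mathbb C}V_\tau\otimes_{\mathbb C} U_t(\mathfrak g))^G$$ be the subalgebras of invariants. Let $I_{PBW}:S(\mathfrak g)\to U_t(\mathfrak g)$ be the linear map with $$I_{PBW}(X_1X_2\cdots X_k)=\frac1{k!}\sum_{\sigma\in S_k}X_{\sigma(1)}X_{\sigma(2)}\cdots X_{\sigma(k)}\qquad(k\ge 0,\ X_i\in\mathfrak g),$$ and let $F_{PBW}=\mathrm{Id}\otimes I_{PBW}:\mathrm{End}_{\mathbb C}V_\tau\otimes_{\mathbb C}S(\mathfrak g)\to\mathrm{End}_{\mathbb C}V_\tau\otimes_{\mathbb C}U_t(\mathfrak g)$. Then the image of $\mathcal C_\tau(\mathfrak g)$ under $F_{PBW}$ is exactly $\mathcal Q^t_\tau(\mathfrak g)$, and the restriction $F_{PBW}:\mathcal C_\tau(\mathfrak g)\to\mathcal Q^t_\tau(\mathfrak g)$ is an isomorphism of vector spaces. -/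

import Mathlib

open scoped TensorProduct Manifold ContDiff

noncomputable section

namespace FamilyAlgebra

/-! ### The deformed enveloping algebra and the Poincaré–Birkhoff–Witt map -/

section PBW

variable {L : Type*} [LieRing L] [LieAlgebra ℂ L]

variable (L) in
/-- The relations `X ⊗ Y - Y ⊗ X = t [X, Y]`, written without subtraction. -/
inductive EnvRel (t : ℂ) : TensorAlgebra ℂ L → TensorAlgebra ℂ L → Prop
  | mk (X Y : L) : EnvRel t
      (TensorAlgebra.ι ℂ X * TensorAlgebra.ι ℂ Y)
      (TensorAlgebra.ι ℂ Y * TensorAlgebra.ι ℂ X + t • TensorAlgebra.ι ℂ ⁅X, Y⁆)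

variable (L) in
/-- `U_t(L) = T(L) / (X ⊗ Y - Y ⊗ X - t [X, Y])`. -/
abbrev DefEnv (t : ℂ) : Type _ := RingQuot (EnvRel L t)

/-- The canonical linear map `L → U_t(L)`. -/
def DefEnv.ι (t : ℂ) : L →ₗ[ℂ] DefEnv L t :=
  (RingQuot.mkAlgHom ℂ (EnvRel L t)).toLinearMap ∘ₗ TensorAlgebra.ι ℂ

/-- A Lie algebra endomorphism `f` of `L` extends to the algebra endomorphism of `U_t(L)` given by
`X₁ ⋯ Xₖ ↦ f X₁ ⋯ f Xₖ`. -/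
def DefEnv.map (t : ℂ) (f : L →ₗ⁅ℂ⁆ L) : DefEnv L t →ₐ[ℂ] DefEnv L t :=
  RingQuot.liftAlgHom ℂ
    ⟨TensorAlgebra.lift ℂ (DefEnv.ι t ∘ₗ (f : L →ₗ[ℂ] L)), by
      rintro _ _ ⟨X, Y⟩
      have h := RingQuot.mkAlgHom_rel ℂ (EnvRel.mk (t := t) (f X) (f Y))
      simpa [DefEnv.ι] using h⟩

@[simp]
theorem DefEnv.map_ι (t : ℂ) (f : L →ₗ⁅ℂ⁆ L) (X : L) :
    DefEnv.map t f (DefEnv.ι t X) = DefEnv.ι t (f X) := by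
  simp [DefEnv.map, DefEnv.ι]

/-- A linear endomorphism `f` of `L` extends to the algebra endomorphism of `S(L)` given by
`X₁ ⋯ Xₖ ↦ f X₁ ⋯ f Xₖ`. -/
def symMap (f : L →ₗ[ℂ] L) : SymmetricAlgebra ℂ L →ₐ[ℂ] SymmetricAlgebra ℂ L :=
  SymmetricAlgebra.lift (SymmetricAlgebra.ι ℂ L ∘ₗ f)

variable (L) in
/-- The multilinear map `(X₁, …, Xₖ) ↦ (1 / k!) ∑_σ X_{σ(1)} ⋯ X_{σ(k)}` with values
in `U_t(L)`. -/
def symmetrization (t : ℂ) (k : ℕ) : MultilinearMap ℂ (fun _ : Fin k => L) (DefEnv L t) :=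
  (k.factorial : ℂ)⁻¹ • ∑ σ : Equiv.Perm (Fin k),
    ((MultilinearMap.mkPiAlgebraFin ℂ k (DefEnv L t)).compLinearMap
      fun _ => DefEnv.ι t).domDomCongr σ

theorem symmetrization_apply (t : ℂ) (k : ℕ) (X : Fin k → L) :
    symmetrization L t k X = (k.factorial : ℂ)⁻¹ • ∑ σ : Equiv.Perm (Fin k),
      (List.ofFn fun i => DefEnv.ι t (X (σ i))).prod := by
  simp [symmetrization]

theorem symmetrization_comp_perm (t : ℂ) (k : ℕ) (X : Fin k → L) (σ : Equiv.Perm (Fin k)) :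
    symmetrization L t k (X ∘ σ) = symmetrization L t k X := by
  simp only [symmetrization_apply, Function.comp_apply]
  congr 1
  exact Fintype.sum_equiv (Equiv.mulLeft σ) _ _ fun τ => rfl

variable (L) in
/-- Symmetrization as a linear map on the tensor algebra. -/
def tensorPBW (t : ℂ) : TensorAlgebra ℂ L →ₗ[ℂ] DefEnv L t :=
  DirectSum.toModule ℂ ℕ (DefEnv L t) (fun k => PiTensorProduct.lift (symmetrization L t k)) ∘ₗ
    TensorAlgebra.equivDirectSum.toLinearMap

theorem tensorPBW_ofFn (t : ℂ) (k : ℕ) (X : Fin k → L) :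
    tensorPBW L t (List.ofFn fun i => TensorAlgebra.ι ℂ (X i)).prod = symmetrization L t k X := by
  rw [← TensorAlgebra.tprod_apply]
  have h := TensorAlgebra.toDirectSum_tensorPower_tprod (R := ℂ) X
  simp only [tensorPBW, LinearMap.comp_apply, AlgEquiv.toLinearMap_apply,
    TensorAlgebra.equivDirectSum_apply]
  rw [h, ← DirectSum.lof_eq_of ℂ, DirectSum.toModule_lof, PiTensorProduct.lift.tprod]

theorem tensorPBW_perm (t : ℂ) {l₁ l₂ : List L} (h : l₁.Perm l₂) :
    tensorPBW L t (l₁.map (TensorAlgebra.ι ℂ)).prod =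
      tensorPBW L t (l₂.map (TensorAlgebra.ι ℂ)).prod := by
  obtain ⟨k, X, rfl⟩ : ∃ (k : ℕ) (X : Fin k → L), l₁ = List.ofFn X :=
    ⟨_, l₁.get, (List.ofFn_get l₁).symm⟩
  obtain ⟨Y, rfl⟩ : ∃ Y : Fin k → L, l₂ = List.ofFn Y := by
    have hl : l₂.length = k := by simpa using h.length_eq.symm
    subst hl
    exact ⟨l₂.get, (List.ofFn_get l₂).symm⟩
  have hm : (Finset.univ : Finset (Fin k)).val.map X = Finset.univ.val.map Y := by
    rw [Fin.univ_val_map, Fin.univ_val_map]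
    exact Multiset.coe_eq_coe.2 h
  obtain ⟨σ, rfl⟩ : ∃ σ : Equiv.Perm (Fin k), X = Y ∘ σ := by
    classical
    have hc (c : L) : Fintype.card {i // X i = c} = Fintype.card {i // Y i = c} := by
      have := congrArg (Multiset.count c) hm
      rw [Multiset.count_map, Multiset.count_map] at this
      simpa only [Fintype.card_subtype, Finset.card_def, Finset.filter_val, eq_comm] using this
    exact ⟨Equiv.ofFiberEquiv fun c => Fintype.equivOfCardEq (hc c),
      funext fun i => (Equiv.ofFiberEquiv_map _ i).symm⟩
  have e (Z : Fin k → L) : (List.ofFn Z).map (TensorAlgebra.ι ℂ) =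
      List.ofFn fun i => TensorAlgebra.ι ℂ (Z i) := by
    rw [List.map_ofFn]; rfl
  rw [e, e, tensorPBW_ofFn, tensorPBW_ofFn, symmetrization_comp_perm]

/-- Two linear maps on `T(L)` that agree on all products of elements of `L` are equal. -/
theorem tensor_ext {M : Type*} [AddCommGroup M] [Module ℂ M] {f g : TensorAlgebra ℂ L →ₗ[ℂ] M}
    (h : ∀ l : List L, f (l.map (TensorAlgebra.ι ℂ)).prod = g (l.map (TensorAlgebra.ι ℂ)).prod) :
    f = g := by
  have hs : Submodule.span ℂ
      (Submonoid.closure (Set.range (TensorAlgebra.ι ℂ (M := L))) : Set (TensorAlgebra ℂ L)) =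
        ⊤ := by
    rw [← Algebra.adjoin_eq_span, TensorAlgebra.adjoin_range_ι, Algebra.top_toSubmodule]
  refine LinearMap.ext_on hs fun x hx => ?_
  obtain ⟨l, hl, rfl⟩ := Submonoid.exists_list_of_mem_closure hx
  obtain ⟨l, rfl⟩ : ∃ l' : List L, l = l'.map (TensorAlgebra.ι ℂ) := by
    have : l ∈ Set.range (List.map (TensorAlgebra.ι ℂ (M := L))) := by
      rw [Set.range_list_map]; exact hl
    obtain ⟨l', h'⟩ := this
    exact ⟨l', h'.symm⟩
  exact h l

theorem tensorPBW_swap (t : ℂ) (X Y : L) (a b : TensorAlgebra ℂ L) :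
    tensorPBW L t (a * (TensorAlgebra.ι ℂ X * TensorAlgebra.ι ℂ Y) * b) =
      tensorPBW L t (a * (TensorAlgebra.ι ℂ Y * TensorAlgebra.ι ℂ X) * b) := by
  let B (Z W : L) (b : TensorAlgebra ℂ L) : TensorAlgebra ℂ L →ₗ[ℂ] DefEnv L t :=
    tensorPBW L t ∘ₗ LinearMap.mulRight ℂ (TensorAlgebra.ι ℂ Z * TensorAlgebra.ι ℂ W * b)
  let A (Z W : L) (a : TensorAlgebra ℂ L) : TensorAlgebra ℂ L →ₗ[ℂ] DefEnv L t :=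
    tensorPBW L t ∘ₗ LinearMap.mulLeft ℂ (a * (TensorAlgebra.ι ℂ Z * TensorAlgebra.ι ℂ W))
  have key : B X Y b = B Y X b := by
    refine tensor_ext fun l => ?_
    have : A X Y (l.map (TensorAlgebra.ι ℂ)).prod = A Y X (l.map (TensorAlgebra.ι ℂ)).prod := by
      refine tensor_ext fun m => ?_
      have := tensorPBW_perm (t := t) (l₁ := l ++ (X :: Y :: m)) (l₂ := l ++ (Y :: X :: m))
        ((List.Perm.swap Y X m).append_left l)
      simpa [A, mul_assoc] using this
    simpa [A, B, mul_assoc] using LinearMap.congr_fun this b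
  simpa [B, mul_assoc] using LinearMap.congr_fun key a

theorem tensorPBW_eq_of_algHom_eq (t : ℂ) {p q : TensorAlgebra ℂ L}
    (h : SymmetricAlgebra.algHom ℂ L p = SymmetricAlgebra.algHom ℂ L q) :
    tensorPBW L t p = tensorPBW L t q := by
  let c : RingCon (TensorAlgebra ℂ L) :=
    { r := fun p q => ∀ a b, tensorPBW L t (a * p * b) = tensorPBW L t (a * q * b)
      iseqv := ⟨fun _ _ _ => rfl, fun h a b => (h a b).symm,
        fun h h' a b => (h a b).trans (h' a b)⟩
      mul' := fun {w x y z} h h' a b => by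
        have h1 := h a (y * b)
        have h2 := h' (a * x) b
        simp only [mul_assoc] at h1 h2 ⊢
        rw [h1, h2]
      add' := fun h h' a b => by
        simp only [mul_add, add_mul, map_add, h a b, h' a b] }
  have hc : TensorAlgebra.symRingCon ℂ L ≤ c := by
    rw [TensorAlgebra.symRingCon, RingCon.ringConGen_le]
    rintro _ _ ⟨X, Y⟩
    exact tensorPBW_swap t X Y
  have h' : TensorAlgebra.symRingCon ℂ L p q := (RingCon.eq _).1 h
  simpa using hc h' 1 1

variable (L) in
/-- The Poincaré–Birkhoff–Witt map `S(L) → U_t(L)`: symmetrization, which vanishes on the kernel of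
`T(L) → S(L)`, passed to the quotient. -/
def IPBW (t : ℂ) : SymmetricAlgebra ℂ L →ₗ[ℂ] DefEnv L t :=
  (LinearMap.ker (SymmetricAlgebra.algHom ℂ L).toLinearMap).liftQ (tensorPBW L t)
      (fun p hp => by
        have := tensorPBW_eq_of_algHom_eq t (p := p) (q := 0) (by simpa using hp)
        simpa using this) ∘ₗ
    ((SymmetricAlgebra.algHom ℂ L).toLinearMap.quotKerEquivOfSurjective
      (SymmetricAlgebra.algHom_surjective ℂ L)).symm.toLinearMap

/-- `X₁ ⋯ Xₖ ↦ (1 / k!) ∑_σ X_{σ(1)} ⋯ X_{σ(k)}`. -/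
theorem IPBW_apply (t : ℂ) (k : ℕ) (X : Fin k → L) :
    IPBW L t (∏ i, SymmetricAlgebra.ι ℂ L (X i)) =
      (k.factorial : ℂ)⁻¹ • ∑ σ : Equiv.Perm (Fin k),
        (List.ofFn fun i => DefEnv.ι t (X (σ i))).prod := by
  have e : ∏ i, SymmetricAlgebra.ι ℂ L (X i) = (SymmetricAlgebra.algHom ℂ L).toLinearMap
      (List.ofFn fun i => TensorAlgebra.ι ℂ (X i)).prod := by
    rw [← List.prod_ofFn]
    simp only [AlgHom.toLinearMap_apply, map_list_prod, List.map_ofFn]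
    rfl
  rw [e, IPBW, LinearMap.comp_apply]
  have e2 : ((SymmetricAlgebra.algHom ℂ L).toLinearMap.quotKerEquivOfSurjective
      (SymmetricAlgebra.algHom_surjective ℂ L)).symm.toLinearMap
        ((SymmetricAlgebra.algHom ℂ L).toLinearMap
          (List.ofFn fun i => TensorAlgebra.ι ℂ (X i)).prod) =
      Submodule.Quotient.mk (List.ofFn fun i => TensorAlgebra.ι ℂ (X i)).prod := by
    rw [LinearEquiv.coe_coe, LinearEquiv.symm_apply_eq]
    rfl
  rw [e2]
  exact (tensorPBW_ofFn t k X).trans (symmetrization_apply t k X)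

variable (L) in
/-- `F_PBW = Id ⊗ I_PBW : End V ⊗ S(L) → End V ⊗ U_t(L)`. -/
def FPBW (V : Type*) [AddCommGroup V] [Module ℂ V] (t : ℂ) :
    Module.End ℂ V ⊗[ℂ] SymmetricAlgebra ℂ L →ₗ[ℂ] Module.End ℂ V ⊗[ℂ] DefEnv L t :=
  TensorProduct.map LinearMap.id (IPBW L t)

end PBW

/-! ### The adjoint action of a complex Lie group -/

section Conj

variable {G : Type*} [Group G]

/-- Conjugation `h ↦ g * h * g⁻¹`. -/
def conj (g h : G) : G := g * h * g⁻¹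

theorem conj_one (g : G) : conj g 1 = 1 := by simp [conj]

theorem conj_inv_conj (g h : G) : conj g⁻¹ (conj g h) = h := by simp [conj, mul_assoc]

theorem conj_conj_inv (g h : G) : conj g (conj g⁻¹ h) = h := by simp [conj, mul_assoc]

end Conj

section Adjoint

variable {E : Type*} [NormedAddCommGroup E] [NormedSpace ℂ E]
  {G : Type*} [TopologicalSpace G] [ChartedSpace E G]

variable (E) in
/-- The manifold derivative of a self-map of `G`; every tangent space of `G` is the model
space `E`. -/
def mderiv (f : G → G) (x : G) : E →L[ℂ] E := mfderiv 𝓘(ℂ, E) 𝓘(ℂ, E) f x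

theorem mderiv_comp {f g : G → G} (hf : ContMDiff 𝓘(ℂ, E) 𝓘(ℂ, E) ω f)
    (hg : ContMDiff 𝓘(ℂ, E) 𝓘(ℂ, E) ω g) (x : G) :
    mderiv E (g ∘ f) x = mderiv E g (f x) ∘L mderiv E f x :=
  mfderiv_comp x (hg.mdifferentiable (by simp) _) (hf.mdifferentiable (by simp) _)

theorem mderiv_id (x : G) : mderiv E id x = ContinuousLinearMap.id ℂ E := mfderiv_id

variable [Group G]

variable (E) in
/-- The derivative at `1` of the conjugation `h ↦ g * h * g⁻¹`, which fixes `1`. -/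
def adLinear (g : G) : GroupLieAlgebra 𝓘(ℂ, E) G →ₗ[ℂ] GroupLieAlgebra 𝓘(ℂ, E) G :=
  (mderiv E (conj g) 1).toLinearMap

variable [LieGroup 𝓘(ℂ, E) ω G]

theorem contMDiff_conj (g : G) : ContMDiff 𝓘(ℂ, E) 𝓘(ℂ, E) ω (conj g) :=
  (contMDiff_const.mul contMDiff_id).mul contMDiff_const

theorem mderiv_conj_isInvertible (g h : G) : (mderiv E (conj g) h).IsInvertible := by
  refine ContinuousLinearMap.IsInvertible.of_inverse (g := mderiv E (conj g⁻¹) (conj g h)) ?_ ?_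
  · have := mderiv_comp (contMDiff_conj (E := E) g⁻¹) (contMDiff_conj g) (conj g h)
    rw [conj_inv_conj, show conj g ∘ conj g⁻¹ = id from funext (conj_conj_inv g), mderiv_id] at this
    exact this.symm
  · have := mderiv_comp (contMDiff_conj (E := E) g) (contMDiff_conj g⁻¹) h
    rw [show conj g⁻¹ ∘ conj g = id from funext (conj_inv_conj g), mderiv_id] at this
    exact this.symm

theorem mpullback_conj_mulInvariantVectorField (g : G) (v : GroupLieAlgebra 𝓘(ℂ, E) G) :
    VectorField.mpullback 𝓘(ℂ, E) 𝓘(ℂ, E) (conj g)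
      (mulInvariantVectorField (adLinear E g v)) =
        mulInvariantVectorField v := by
  ext h
  refine ((mderiv_conj_isInvertible (E := E) g h).inverse_apply_eq).2 ?_
  change mderiv E (fun x => conj g h * x) 1 (mderiv E (conj g) 1 v) =
    mderiv E (conj g) h (mderiv E (fun x => h * x) 1 v)
  have h1 := mderiv_comp (E := E) (f := fun x => h * x) contMDiff_mul_left (contMDiff_conj g) 1
  have h2 := mderiv_comp (E := E) (g := fun x => conj g h * x) (contMDiff_conj g)
    contMDiff_mul_left 1
  have e : conj g ∘ (fun x => h * x) = (fun x => conj g h * x) ∘ conj g := by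
    ext x; simp [conj, mul_assoc]
  rw [e, h2, conj_one, mul_one] at h1
  exact DFunLike.congr_fun h1 v

variable [CompleteSpace E]

theorem adLinear_lie (g : G) (v w : GroupLieAlgebra 𝓘(ℂ, E) G) :
    adLinear E g ⁅v, w⁆ = ⁅adLinear E g v, adLinear E g w⁆ := by
  have h := VectorField.mpullback_mlieBracket (n := ω) (I := 𝓘(ℂ, E)) (I' := 𝓘(ℂ, E))
    (f := conj g) (x₀ := (1 : G))
    (mdifferentiableAt_mulInvariantVectorField (adLinear E g v))
    (mdifferentiableAt_mulInvariantVectorField (adLinear E g w))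
    (contMDiff_conj g).contMDiffAt le_top
  rw [mpullback_conj_mulInvariantVectorField, mpullback_conj_mulInvariantVectorField] at h
  have h' := ((mderiv_conj_isInvertible (E := E) g 1).inverse_apply_eq).1 h
  rw [conj_one] at h'
  exact h'.symm

variable (E) in
/-- The adjoint action of `g : G` on the Lie algebra of `G`: the derivative at `1` of the
conjugation `h ↦ g * h * g⁻¹`. -/
def adGroup (g : G) : GroupLieAlgebra 𝓘(ℂ, E) G →ₗ⁅ℂ⁆ GroupLieAlgebra 𝓘(ℂ, E) G :=
  { adLinear E g with map_lie' := fun {v w} => adLinear_lie g v w }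

end Adjoint

/-! ### The family algebras

Throughout, `e` identifies the Lie algebra of the complex Lie group `G` with `L`. -/

section Family

variable {E : Type*} [NormedAddCommGroup E] [NormedSpace ℂ E] [CompleteSpace E]
  {G : Type*} [TopologicalSpace G] [ChartedSpace E G] [Group G] [LieGroup 𝓘(ℂ, E) ω G]
  {L : Type*} [LieRing L] [LieAlgebra ℂ L] (e : GroupLieAlgebra 𝓘(ℂ, E) G ≃ₗ⁅ℂ⁆ L)
  {V : Type*} [AddCommGroup V] [Module ℂ V]

/-- The adjoint action of `g : G` on `L`. -/
def ad (g : G) : L →ₗ⁅ℂ⁆ L :=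
  e.toLieHom.comp ((adGroup E g).comp e.symm.toLieHom)

/-- The representation `T` of the complex Lie group `G` on the finite dimensional space `V` is
holomorphic and its differential at `1` is the given representation `τ` of `L` on `V`, which is
written `τ(X) v = ⁅X, v⁆`. Both are expressed through the matrix coefficients `g ↦ φ (T g v)`. When `G` is connected and simply connected there
is exactly one such `T`: it is the representation of `G` to which `τ` gives rise. -/
structure Integrates [LieRingModule L V] [LieModule ℂ L V] (T : Representation ℂ G V) : Prop where
  holomorphic : ∀ (v : V) (φ : Module.Dual ℂ V),
    ContMDiff 𝓘(ℂ, E) 𝓘(ℂ, ℂ) ω (fun g : G => φ (T g v))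
  differential : ∀ (X : GroupLieAlgebra 𝓘(ℂ, E) G) (v : V) (φ : Module.Dual ℂ V),
    (mfderiv 𝓘(ℂ, E) 𝓘(ℂ, ℂ) (fun g : G => φ (T g v)) 1 X : ℂ) = φ ⁅e X, v⁆

/-- The action `A ↦ T g ∘ A ∘ (T g)⁻¹` of `g : G` on `End V`. -/
def endAct (T : Representation ℂ G V) (g : G) : Module.End ℂ V →ₐ[ℂ] Module.End ℂ V where
  toFun A := T g * A * T g⁻¹
  map_one' := by rw [mul_one, ← map_mul, mul_inv_cancel, map_one]
  map_mul' A B := by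
    have h : T g⁻¹ * T g = 1 := by rw [← map_mul, inv_mul_cancel, map_one]
    calc T g * (A * B) * T g⁻¹ = T g * A * 1 * B * T g⁻¹ := by simp only [mul_assoc, mul_one]
      _ = T g * A * T g⁻¹ * (T g * B * T g⁻¹) := by rw [← h]; simp only [mul_assoc]
  map_zero' := by simp
  map_add' A B := by simp [mul_add, add_mul]
  commutes' c := by
    rw [← Algebra.commutes, mul_assoc, ← map_mul, mul_inv_cancel, map_one, mul_one]

/-- The diagonal action of `g : G` on `End V ⊗ S(L)`. -/
def classicalAct (T : Representation ℂ G V) (g : G) :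
    Module.End ℂ V ⊗[ℂ] SymmetricAlgebra ℂ L →ₐ[ℂ] Module.End ℂ V ⊗[ℂ] SymmetricAlgebra ℂ L :=
  Algebra.TensorProduct.map (endAct T g) (symMap (ad e g : L →ₗ[ℂ] L))

/-- The diagonal action of `g : G` on `End V ⊗ U_t(L)`. -/
def quantumAct (T : Representation ℂ G V) (t : ℂ) (g : G) :
    Module.End ℂ V ⊗[ℂ] DefEnv L t →ₐ[ℂ] Module.End ℂ V ⊗[ℂ] DefEnv L t :=
  Algebra.TensorProduct.map (endAct T g) (DefEnv.map t (ad e g))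

/-- The classical family algebra `(End V ⊗ S(L))^G`. -/
def classicalFamilyAlgebra (T : Representation ℂ G V) :
    Subalgebra ℂ (Module.End ℂ V ⊗[ℂ] SymmetricAlgebra ℂ L) where
  carrier := {x | ∀ g : G, classicalAct e T g x = x}
  mul_mem' hx hy g := by rw [map_mul, hx g, hy g]
  add_mem' hx hy g := by rw [map_add, hx g, hy g]
  algebraMap_mem' c g := AlgHom.commutes _ c

/-- The quantum family algebra `(End V ⊗ U_t(L))^G` with deformation parameter `t`. -/
def quantumFamilyAlgebra (T : Representation ℂ G V) (t : ℂ) :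
    Subalgebra ℂ (Module.End ℂ V ⊗[ℂ] DefEnv L t) where
  carrier := {x | ∀ g : G, quantumAct e T t g x = x}
  mul_mem' hx hy g := by rw [map_mul, hx g, hy g]
  add_mem' hx hy g := by rw [map_add, hx g, hy g]
  algebraMap_mem' c g := AlgHom.commutes _ c

end Family

end FamilyAlgebra

end

noncomputable section

namespace FamilyAlgebra

/-! ### Surjectivity of symmetrization, by the word-length filtration -/

section Surjective

variable {L : Type*} [LieRing L] [LieAlgebra ℂ L] (t : ℂ)

/-! Symmetrization commutes with the adjoint action, since `G` acts on both sides by algebra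
homomorphisms extending the same map of Lie algebras (`IPBW_symMap`). If `IPBW` is bijective, then
so is `FPBW`, and an equivariant bijection matches invariants with invariants. Everything thus rests
on the Poincaré–Birkhoff–Witt theorem in the form `IPBW_bijective`.

Surjectivity: permuting a word changes it only by shorter words, so by induction on length each word
is its symmetrization plus an element already in the range.

Injectivity for `t = 0`: the map `U_0(L) → S(L)` is a left inverse. For `t ≠ 0` the group supplies a
faithful enough module. The left invariant vector fields, multiplied by `t` and read in the chart at
`1`, make `U_t(L)` act on analytic functions. At the base point there are coordinates `x` dual to a
basis of the fields, and modulo higher order of vanishing the basis fields act on polynomials in `x`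
as `∂/∂xᵢ`. If `α` is a monomial of maximal degree in `s`, applying `IPBW s` to `x^α` and evaluating
at the base point gives a nonzero multiple of the coefficient of `α` in `s`
(`IPBW_injective_of_derivations`). -/

theorem DefEnv.ι_mul_ι (X Y : L) :
    DefEnv.ι t X * DefEnv.ι t Y = DefEnv.ι t Y * DefEnv.ι t X + t • DefEnv.ι t ⁅X, Y⁆ := by
  simpa [DefEnv.ι] using RingQuot.mkAlgHom_rel ℂ (EnvRel.mk (t := t) X Y)

variable (L) in
/-- The filtration of `U_t(L)` by the length of words in `L`. -/
def DefEnv.filtration (n : ℕ) : Submodule ℂ (DefEnv L t) :=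
  Submodule.span ℂ {u | ∃ l : List L, l.length ≤ n ∧ u = (l.map (DefEnv.ι t)).prod}

theorem DefEnv.prod_mem_filtration {n : ℕ} {l : List L} (h : l.length ≤ n) :
    (l.map (DefEnv.ι t)).prod ∈ DefEnv.filtration L t n :=
  Submodule.subset_span ⟨l, h, rfl⟩

theorem DefEnv.ι_mul_mem_filtration {n : ℕ} (X : L) {u : DefEnv L t}
    (h : u ∈ DefEnv.filtration L t n) :
    DefEnv.ι t X * u ∈ DefEnv.filtration L t (n + 1) := by
  have : DefEnv.filtration L t n ≤
      (DefEnv.filtration L t (n + 1)).comap (LinearMap.mulLeft ℂ (DefEnv.ι t X)) := by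
    refine Submodule.span_le.2 ?_
    rintro _ ⟨l, hl, rfl⟩
    have := DefEnv.prod_mem_filtration t (n := n + 1) (l := X :: l) (by simpa using hl)
    simpa using this
  exact this h

/-- An adjacent transposition costs `t` times a word in which two letters are replaced by their
bracket, hence a word one letter shorter; adjacent transpositions generate all permutations. -/
theorem DefEnv.prod_sub_prod_mem_filtration {l l' : List L} (h : l.Perm l') :
    ∀ n, l.length ≤ n + 1 →
      (l.map (DefEnv.ι t)).prod - (l'.map (DefEnv.ι t)).prod ∈ DefEnv.filtration L t n := by
  induction h with
  | nil => intro n _; simp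
  | cons X h ih =>
    rename_i l₁ l₂
    intro n hn
    -- At `n = 0` the tail is empty and the difference is zero; the induction hypothesis would need
    -- level `-1`.
    rcases n with _ | n
    · have h1 : l₁ = [] := by simpa using hn
      subst h1
      simp [List.nil_perm.1 h]
    · have := DefEnv.ι_mul_mem_filtration t X (ih n (by simpa using hn))
      simpa [mul_sub] using this
  | swap X Y l =>
    intro n hn
    have := DefEnv.prod_mem_filtration t (n := n) (l := ⁅Y, X⁆ :: l) (by simpa using hn)
    have e : ((Y :: X :: l).map (DefEnv.ι t)).prod - ((X :: Y :: l).map (DefEnv.ι t)).prod =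
        t • ((⁅Y, X⁆ :: l).map (DefEnv.ι t)).prod := by
      simp only [List.map_cons, List.prod_cons, ← mul_assoc]
      rw [DefEnv.ι_mul_ι t Y X, add_mul, add_sub_cancel_left, smul_mul_assoc]
    rw [e]
    exact Submodule.smul_mem _ _ this
  | trans h₁ _ ih₁ ih₂ =>
    intro n hn
    have := Submodule.add_mem _ (ih₁ n hn) (ih₂ n (h₁.length_eq ▸ hn))
    simpa using this

theorem DefEnv.mem_filtration (u : DefEnv L t) : ∃ n, u ∈ DefEnv.filtration L t n := by
  obtain ⟨p, rfl⟩ := RingQuot.mkAlgHom_surjective ℂ (EnvRel L t) u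
  have hmono : Monotone (DefEnv.filtration L t) := fun m n h =>
    Submodule.span_mono fun _ ⟨l, hl, e⟩ => ⟨l, hl.trans h, e⟩
  have h : (⊤ : Submodule ℂ (TensorAlgebra ℂ L)) ≤
      (⨆ n, DefEnv.filtration L t n).comap (RingQuot.mkAlgHom ℂ (EnvRel L t)).toLinearMap := by
    have hs : Submodule.span ℂ (Submonoid.closure (Set.range (TensorAlgebra.ι ℂ (M := L))) :
        Set (TensorAlgebra ℂ L)) = ⊤ := by
      rw [← Algebra.adjoin_eq_span, TensorAlgebra.adjoin_range_ι, Algebra.top_toSubmodule]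
    rw [← hs]
    refine Submodule.span_le.2 fun x hx => ?_
    obtain ⟨l, hl, rfl⟩ := Submonoid.exists_list_of_mem_closure hx
    obtain ⟨l, rfl⟩ : l ∈ Set.range (List.map (TensorAlgebra.ι ℂ (M := L))) := by
      rw [Set.range_list_map]; exact hl
    refine Submodule.mem_iSup_of_mem l.length ?_
    have := DefEnv.prod_mem_filtration t (le_refl l.length)
    simpa [DefEnv.ι, map_list_prod, Function.comp_def] using this
  exact (Submodule.mem_iSup_of_directed _ hmono.directed_le).1 (h (Submodule.mem_top (x := p)))

theorem DefEnv.filtration_le_range_IPBW (n : ℕ) :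
    DefEnv.filtration L t n ≤ LinearMap.range (IPBW L t) := by
  induction n with
  | zero =>
    refine Submodule.span_le.2 ?_
    rintro _ ⟨l, hl, rfl⟩
    have : l = [] := by simpa using hl
    subst this
    exact ⟨1, by simpa using IPBW_apply t 0 (fun i : Fin 0 => (0 : L))⟩
  | succ n ih =>
    refine Submodule.span_le.2 ?_
    rintro _ ⟨l, hl, rfl⟩
    obtain ⟨k, X, rfl⟩ : ∃ (k : ℕ) (X : Fin k → L), l = List.ofFn X :=
      ⟨_, l.get, (List.ofFn_get l).symm⟩
    -- A word is its symmetrization plus the average of its differences from its rearrangements, and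
    -- these differences lie one step lower in the filtration.
    have key : ((List.ofFn X).map (DefEnv.ι t)).prod =
        IPBW L t (∏ i, SymmetricAlgebra.ι ℂ L (X i)) + (k.factorial : ℂ)⁻¹ •
          ∑ σ : Equiv.Perm (Fin k), (((List.ofFn X).map (DefEnv.ι t)).prod -
            ((List.ofFn (X ∘ σ)).map (DefEnv.ι t)).prod) := by
      have hk : (k.factorial : ℂ) ≠ 0 := by exact_mod_cast k.factorial_ne_zero
      rw [IPBW_apply, Finset.sum_sub_distrib, Finset.sum_const, smul_sub, Finset.card_univ,
        Fintype.card_perm, Fintype.card_fin, ← Nat.cast_smul_eq_nsmul ℂ, smul_smul,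
        inv_mul_cancel₀ hk, one_smul]
      simp [List.map_ofFn, Function.comp_def]
    rw [SetLike.mem_coe, key]
    refine Submodule.add_mem _ ⟨_, rfl⟩ (Submodule.smul_mem _ _ (Submodule.sum_mem _ fun σ _ =>
      ih (DefEnv.prod_sub_prod_mem_filtration t ?_ n hl)))
    exact (Equiv.Perm.ofFn_comp_perm σ X).symm

theorem IPBW_surjective : Function.Surjective (IPBW L t) := fun u =>
  let ⟨n, hn⟩ := DefEnv.mem_filtration t u
  DefEnv.filtration_le_range_IPBW t n hn

end Surjective

/-! ### Derivations and polynomials modulo powers of an ideal -/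

section Symbols

open MvPolynomial

variable {κ A : Type*} [CommRing A] [Algebra ℂ A]

/-- By the Leibniz rule, differentiation lowers the order of vanishing by at most one. -/
theorem derivation_mem_pow (D : Derivation ℂ A A) (J : Ideal A) (n : ℕ) {a : A}
    (ha : a ∈ J ^ (n + 1)) : D a ∈ J ^ n := by
  induction n generalizing a with
  | zero => simp
  | succ n ih =>
    rw [pow_succ' J (n + 1)] at ha
    refine Submodule.mul_induction_on ha (fun x hx y hy => ?_) fun x y hx hy => ?_
    · rw [D.leibniz, smul_eq_mul, smul_eq_mul]
      refine Ideal.add_mem _ ?_ (Ideal.mul_mem_right _ _ hy)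
      rw [pow_succ']
      exact Ideal.mul_mem_mul hx (ih hy)
    · rw [map_add]; exact Ideal.add_mem _ hx hy

theorem aeval_mem_pow (J : Ideal A) {x : κ → A} (hx : ∀ i, x i ∈ J) {n : ℕ}
    {q : MvPolynomial κ ℂ} (hq : q.IsHomogeneous n) : aeval x q ∈ J ^ n := by
  rw [aeval_def, eval₂_eq]
  refine Ideal.sum_mem _ fun d hd => Ideal.mul_mem_left _ _ ?_
  have hn : ∑ i ∈ d.support, d i = n := by
    have := hq (mem_support_iff.1 hd)
    rw [← this]
    exact DFunLike.congr_fun (Finsupp.degree_eq_weight_one (R := ℕ)) d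
  rw [← hn, ← Finset.prod_pow_eq_pow_sum]
  exact Ideal.prod_mem_prod fun i _ => Ideal.pow_mem_pow (hx i) _

theorem derivation_aeval [Fintype κ] (D : Derivation ℂ A A) (x : κ → A) (q : MvPolynomial κ ℂ) :
    D (aeval x q) = ∑ j, aeval x (pderiv j q) * D (x j) := by
  classical
  induction q using MvPolynomial.induction_on with
  | C a => simp [← algebraMap_eq]
  | add p q hp hq => simp [hp, hq, add_mul, Finset.sum_add_distrib]
  | mul_X p k hp =>
    simp only [map_mul, aeval_X, D.leibniz, hp, smul_eq_mul, Derivation.leibniz, pderiv_X,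
      map_add, add_mul, Finset.sum_add_distrib, Finset.mul_sum, mul_assoc]
    congr 1
    rw [Finset.sum_eq_single k]
    · simp
    · intro j _ hj
      simp [Pi.single_eq_of_ne hj.symm]
    · simp

theorem foldr_pderiv_isHomogeneous {n : ℕ} (l : List κ) {q : MvPolynomial κ ℂ}
    (hq : q.IsHomogeneous (n + l.length)) :
    (l.foldr (fun i => ⇑(pderiv i)) q).IsHomogeneous n := by
  induction l generalizing n with
  | nil => simpa using hq
  | cons i l ih =>
    have := (ih (n := n + 1) (by simpa [add_assoc, add_comm, add_left_comm] using hq)).pderiv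
      (i := i)
    simpa using this

/-- Each derivative shifts the exponent by one and multiplies by a positive integer. Positivity of
`c` later excludes cancellation, and its independence of `q` lets one constant serve all test
polynomials. -/
theorem coeff_foldr_pderiv (l : List κ) (γ : κ →₀ ℕ) : ∃ c : ℕ, 0 < c ∧
    ∀ q : MvPolynomial κ ℂ, coeff γ (l.foldr (fun i => ⇑(pderiv i)) q) =
      c * coeff (γ + (l.map fun i => Finsupp.single i 1).sum) q := by
  induction l generalizing γ with
  | nil => exact ⟨1, one_pos, fun q => by simp⟩
  | cons i l ih =>
    obtain ⟨c, hc, h⟩ := ih (γ + Finsupp.single i 1)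
    refine ⟨(γ i + 1) * c, by positivity, fun q => ?_⟩
    simp only [List.foldr_cons, coeff_pderiv, h]
    push_cast
    rw [List.map_cons, List.sum_cons, ← add_assoc]
    ring

theorem prod_map_X (l : List κ) : (l.map (X (R := ℂ))).prod =
    monomial (l.map fun i => Finsupp.single i 1).sum 1 := by
  induction l with
  | nil => simp
  | cons i l ih =>
    rw [List.map_cons, List.prod_cons, ih, List.map_cons, List.sum_cons, X, monomial_mul, one_mul]

end Symbols

/-! ### Injectivity from derivations with dual coordinates at a point -/

section Injective

open MvPolynomial

variable {L : Type*} [LieRing L] [LieAlgebra ℂ L] {A : Type*} [CommRing A] [Algebra ℂ A]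

/-- An action of `L` on `A` by derivations with `D X ∘ D Y - D Y ∘ D X = t D ⁅X, Y⁆` makes `A` a
module over `U_t(L)`. -/
def derivationAction (t : ℂ) (D : L →ₗ[ℂ] Derivation ℂ A A)
    (hD : ∀ X Y a, D X (D Y a) - D Y (D X a) = t • D ⁅X, Y⁆ a) :
    DefEnv L t →ₐ[ℂ] Module.End ℂ A :=
  RingQuot.liftAlgHom ℂ
    ⟨TensorAlgebra.lift ℂ
      { toFun := fun X => (D X : A →ₗ[ℂ] A)
        map_add' := fun X Y => by simp
        map_smul' := fun c X => by simp }, by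
      rintro _ _ ⟨X, Y⟩
      ext a
      simp [← hD X Y a]⟩

variable {t : ℂ} {D : L →ₗ[ℂ] Derivation ℂ A A}
  {hD : ∀ X Y a, D X (D Y a) - D Y (D X a) = t • D ⁅X, Y⁆ a}

@[simp]
theorem derivationAction_ι (X : L) (a : A) :
    derivationAction t D hD (DefEnv.ι t X) a = D X a := by
  simp [derivationAction, DefEnv.ι]

variable {κ : Type*} [Fintype κ] [DecidableEq κ] {b : Module.Basis κ ℂ L} {ev : A →ₐ[ℂ] ℂ}
  {x : κ → A}

/-- To leading order `D (b i)` is `∂/∂xᵢ`: in the chain rule the error terms pair `∂q/∂xⱼ`, of order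
`n`, with `D (b i) (x j) - δᵢⱼ`, which vanishes at the point. -/
theorem derivation_aeval_sub_mem (hx : ∀ i, ev (x i) = 0)
    (hDx : ∀ i j, ev (D (b i) (x j)) = if i = j then 1 else 0) {n : ℕ} {q : MvPolynomial κ ℂ}
    (hq : q.IsHomogeneous (n + 1)) (i : κ) :
    D (b i) (aeval x q) - aeval x (pderiv i q) ∈ RingHom.ker ev ^ (n + 1) := by
  have e : D (b i) (aeval x q) - aeval x (pderiv i q) =
      ∑ j, aeval x (pderiv j q) * (D (b i) (x j) - if i = j then 1 else 0) := by
    simp [derivation_aeval, mul_sub]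
  rw [e]
  refine Ideal.sum_mem _ fun j _ => ?_
  rw [pow_succ]
  refine Ideal.mul_mem_mul (aeval_mem_pow _ (fun i => hx i) (by simpa using hq.pderiv (i := j))) ?_
  rw [RingHom.mem_ker, map_sub, hDx]
  split_ifs <;> simp

theorem derivationAction_prod_sub_mem (hx : ∀ i, ev (x i) = 0)
    (hDx : ∀ i j, ev (D (b i) (x j)) = if i = j then 1 else 0) (l : List κ) {n : ℕ}
    {q : MvPolynomial κ ℂ} (hq : q.IsHomogeneous (n + l.length)) :
    derivationAction t D hD (l.map fun i => DefEnv.ι t (b i)).prod (aeval x q) -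
      aeval x (l.foldr (fun i => ⇑(pderiv i)) q) ∈ RingHom.ker ev ^ (n + 1) := by
  induction l generalizing n with
  | nil => simp
  | cons i l ih =>
    have hq' : q.IsHomogeneous (n + 1 + l.length) := by
      simpa [add_assoc, add_comm, add_left_comm] using hq
    -- The shorter word is compared modulo order `n + 2`, so one order may be lost here.
    have h1 := derivation_mem_pow (D (b i)) _ _ (ih hq')
    have h2 := derivation_aeval_sub_mem hx hDx (foldr_pderiv_isHomogeneous l hq') i
    have := Ideal.add_mem _ h1 h2
    simpa using this

theorem ev_derivationAction_prod (hx : ∀ i, ev (x i) = 0)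
    (hDx : ∀ i j, ev (D (b i) (x j)) = if i = j then 1 else 0) (l : List κ) {n : ℕ}
    {q : MvPolynomial κ ℂ} (hq : q.IsHomogeneous n) (hl : l.length ≤ n) :
    ev (derivationAction t D hD (l.map fun i => DefEnv.ι t (b i)).prod (aeval x q)) =
      coeff 0 (l.foldr (fun i => ⇑(pderiv i)) q) := by
  obtain ⟨m, rfl⟩ := Nat.exists_eq_add_of_le' hl
  have h := Ideal.pow_le_self (Nat.succ_ne_zero m)
    (derivationAction_prod_sub_mem (hD := hD) hx hDx l hq)
  rw [RingHom.mem_ker, map_sub, sub_eq_zero] at h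
  have hc (p : MvPolynomial κ ℂ) : ev (aeval x p) = coeff 0 p := by
    rw [← constantCoeff_eq, ← AlgHom.comp_apply, comp_aeval]
    simp [hx]
  rw [h, hc]

/-- On test polynomials of degree at least `β.degree`, only leading symbols survive evaluation.
Those of all rearrangements of a word extract the same coefficient, up to positive factors. -/
theorem ev_derivationAction_IPBW_monomial (hx : ∀ i, ev (x i) = 0)
    (hDx : ∀ i j, ev (D (b i) (x j)) = if i = j then 1 else 0) (β : κ →₀ ℕ) :
    ∃ c : ℂ, c ≠ 0 ∧ ∀ (n : ℕ) (q : MvPolynomial κ ℂ), q.IsHomogeneous n → β.degree ≤ n →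
      ev (derivationAction t D hD (IPBW L t ((SymmetricAlgebra.equivMvPolynomial b).symm
        (monomial β 1))) (aeval x q)) = c * coeff β q := by
  obtain ⟨k, I, hI⟩ : ∃ (k : ℕ) (I : Fin k → κ), (List.ofFn I : Multiset κ) = β.toMultiset :=
    ⟨_, β.toMultiset.toList.get, by rw [List.ofFn_get, Multiset.coe_toList]⟩
  have hsum {l : List κ} (hl : (l : Multiset κ) = β.toMultiset) :
      (l.map fun i => Finsupp.single i 1).sum = β := by
    apply Multiset.toFinsupp.symm.injective
    change Finsupp.toMultiset _ = Finsupp.toMultiset _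
    rw [← hl, map_list_sum, List.map_map]
    simp only [Function.comp_def, Finsupp.toMultiset_single, one_smul]
    rw [← Multiset.sum_coe, ← Multiset.map_coe, Multiset.sum_map_singleton]
  have hmon : (SymmetricAlgebra.equivMvPolynomial b).symm (monomial β 1) =
      ∏ i, SymmetricAlgebra.ι ℂ L (b (I i)) := by
    rw [AlgEquiv.symm_apply_eq, map_prod]
    simp only [SymmetricAlgebra.equivMvPolynomial_ι_apply]
    rw [← List.prod_ofFn, ← hsum hI, ← prod_map_X, List.map_ofFn]
    rfl
  have hk : k = β.degree := by
    have := congrArg Multiset.card hI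
    simpa [Finsupp.degree_apply, Finsupp.card_toMultiset, Finsupp.sum] using this
  have hperm (σ : Equiv.Perm (Fin k)) : (List.ofFn (I ∘ σ) : Multiset κ) = β.toMultiset := by
    rw [← hI]; exact Multiset.coe_eq_coe.2 (Equiv.Perm.ofFn_comp_perm σ I)
  choose c hc h using fun σ : Equiv.Perm (Fin k) => coeff_foldr_pderiv (List.ofFn (I ∘ σ)) 0
  -- The average of the positive integers `c σ` over all orderings, hence nonzero.
  refine ⟨(k.factorial : ℂ)⁻¹ * ((∑ σ, c σ : ℕ) : ℂ), mul_ne_zero (inv_ne_zero ?_) ?_, ?_⟩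
  · exact_mod_cast k.factorial_ne_zero
  · exact_mod_cast (Finset.sum_pos (fun σ _ => hc σ) Finset.univ_nonempty).ne'
  · intro n q hq hn
    have e (σ : Equiv.Perm (Fin k)) :
        ev (derivationAction t D hD (List.ofFn fun i => DefEnv.ι t (b (I (σ i)))).prod
          (aeval x q)) = c σ * coeff β q := by
      have := ev_derivationAction_prod (hD := hD) hx hDx (List.ofFn (I ∘ σ)) hq
        (by simpa [hk] using hn)
      rw [h, zero_add, hsum (hperm σ), List.map_ofFn] at this
      exact this
    rw [hmon, IPBW_apply]
    simp only [map_smul, map_sum, LinearMap.smul_apply, LinearMap.sum_apply, e]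
    rw [← Finset.sum_mul, smul_eq_mul, Nat.cast_sum, mul_assoc]

theorem IPBW_injective_of_derivations (hD : ∀ X Y a, D X (D Y a) - D Y (D X a) = t • D ⁅X, Y⁆ a)
    (hx : ∀ i, ev (x i) = 0) (hDx : ∀ i j, ev (D (b i) (x j)) = if i = j then 1 else 0) :
    Function.Injective (IPBW L t) := by
  rw [injective_iff_map_eq_zero]
  intro s hs
  by_contra hne
  set p := SymmetricAlgebra.equivMvPolynomial b s with hp
  have hp0 : p ≠ 0 := by simpa [hp] using hne
  obtain ⟨α, hα, hdeg⟩ := Finset.exists_max_image p.support Finsupp.degree (support_nonempty.2 hp0)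
  choose c hc h using ev_derivationAction_IPBW_monomial (hD := hD) hx hDx
  have hsum : s = ∑ β ∈ p.support,
      coeff β p • (SymmetricAlgebra.equivMvPolynomial b).symm (monomial β 1) := by
    rw [← (SymmetricAlgebra.equivMvPolynomial b).symm_apply_apply s, ← hp]
    conv_lhs => rw [p.as_sum]
    rw [map_sum]
    refine Finset.sum_congr rfl fun β _ => ?_
    rw [← map_smul, smul_monomial, smul_eq_mul, mul_one]
  -- Maximality of `α.degree` makes the previous lemma applicable to every monomial of `p`; those
  -- other than `α` contribute zero.
  have hv : ev (derivationAction t D hD (IPBW L t s) (aeval x (monomial α (1 : ℂ)))) =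
      coeff α p * c α := by
    rw [hsum]
    simp only [map_sum, map_smul, LinearMap.sum_apply, LinearMap.smul_apply]
    rw [Finset.sum_eq_single_of_mem α hα]
    · rw [h α _ _ (isHomogeneous_monomial 1 rfl) le_rfl]
      simp
    · intro β hβ hβα
      rw [h β _ _ (isHomogeneous_monomial 1 rfl) (hdeg β hβ)]
      simp [coeff_monomial, hβα.symm]
  rw [hs] at hv
  exact mul_ne_zero (mem_support_iff.1 hα) (hc α) (by simpa using hv.symm)

end Injective

/-! ### The undeformed case `t = 0` -/

section Zero

variable (L : Type*) [LieRing L] [LieAlgebra ℂ L]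

/-- The canonical algebra homomorphism `U_0(L) → S(L)`. -/
def DefEnv.toSymmetricAlgebra : DefEnv L 0 →ₐ[ℂ] SymmetricAlgebra ℂ L :=
  RingQuot.liftAlgHom ℂ ⟨SymmetricAlgebra.algHom ℂ L, by
    rintro _ _ ⟨X, Y⟩
    rw [zero_smul, add_zero, map_mul, map_mul, mul_comm]⟩

theorem DefEnv.toSymmetricAlgebra_ι (X : L) :
    DefEnv.toSymmetricAlgebra L (DefEnv.ι 0 X) = SymmetricAlgebra.ι ℂ L X := by
  simp [DefEnv.toSymmetricAlgebra, DefEnv.ι, SymmetricAlgebra.ι]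

variable {L}

/-- Two linear maps on `S(L)` that agree on all products of elements of `L` are equal. -/
theorem symmetric_ext {M : Type*} [AddCommGroup M] [Module ℂ M]
    {f g : SymmetricAlgebra ℂ L →ₗ[ℂ] M}
    (h : ∀ (k : ℕ) (X : Fin k → L), f (∏ i, SymmetricAlgebra.ι ℂ L (X i)) =
      g (∏ i, SymmetricAlgebra.ι ℂ L (X i))) : f = g := by
  have : f ∘ₗ (SymmetricAlgebra.algHom ℂ L).toLinearMap =
      g ∘ₗ (SymmetricAlgebra.algHom ℂ L).toLinearMap := by
    refine tensor_ext fun l => ?_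
    have e : SymmetricAlgebra.algHom ℂ L (l.map (TensorAlgebra.ι ℂ)).prod =
        ∏ i, SymmetricAlgebra.ι ℂ L (l.get i) := by
      rw [← List.prod_ofFn, map_list_prod, List.map_map]
      conv_lhs => rw [← List.ofFn_get l, List.map_ofFn]
      rfl
    simp only [LinearMap.comp_apply, AlgHom.toLinearMap_apply, e, h]
  ext s
  obtain ⟨p, rfl⟩ := SymmetricAlgebra.algHom_surjective ℂ L s
  exact LinearMap.congr_fun this p

variable (L)

/-- In the commutative algebra `S(L)` all `k!` summands of a symmetrization become the same product.
-/
theorem IPBW_zero_injective : Function.Injective (IPBW L 0) := by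
  have h : (DefEnv.toSymmetricAlgebra L).toLinearMap ∘ₗ IPBW L 0 = LinearMap.id := by
    refine symmetric_ext fun k X => ?_
    have hk : (k.factorial : ℂ) ≠ 0 := by exact_mod_cast k.factorial_ne_zero
    have e (σ : Equiv.Perm (Fin k)) :
        DefEnv.toSymmetricAlgebra L (List.ofFn fun i => DefEnv.ι 0 (X (σ i))).prod =
          ∏ i, SymmetricAlgebra.ι ℂ L (X i) := by
      rw [map_list_prod, List.map_ofFn, List.prod_ofFn]
      simp only [Function.comp_apply, DefEnv.toSymmetricAlgebra_ι]
      exact Equiv.prod_comp σ fun i => SymmetricAlgebra.ι ℂ L (X i)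
    simp only [LinearMap.comp_apply, IPBW_apply, AlgHom.toLinearMap_apply, map_smul, map_sum, e,
      Finset.sum_const, Finset.card_univ, Fintype.card_perm, Fintype.card_fin, LinearMap.id_apply]
    rw [← Nat.cast_smul_eq_nsmul ℂ, smul_smul, inv_mul_cancel₀ hk, one_smul]
  exact Function.LeftInverse.injective (g := DefEnv.toSymmetricAlgebra L) (LinearMap.congr_fun h)

end Zero

/-! ### Equivariance and reduction to bijectivity of symmetrization -/

section Equivariance

variable {L : Type*} [LieRing L] [LieAlgebra ℂ L]

theorem IPBW_symMap (t : ℂ) (f : L →ₗ⁅ℂ⁆ L) (s : SymmetricAlgebra ℂ L) :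
    IPBW L t (symMap (f : L →ₗ[ℂ] L) s) = DefEnv.map t f (IPBW L t s) := by
  have : IPBW L t ∘ₗ (symMap (f : L →ₗ[ℂ] L)).toLinearMap =
      (DefEnv.map t f).toLinearMap ∘ₗ IPBW L t := by
    refine symmetric_ext fun k X => ?_
    have e : symMap (f : L →ₗ[ℂ] L) (∏ i, SymmetricAlgebra.ι ℂ L (X i)) =
        ∏ i, SymmetricAlgebra.ι ℂ L (f (X i)) := by
      simp [symMap]
    simp only [LinearMap.comp_apply, AlgHom.toLinearMap_apply, e, IPBW_apply, map_smul, map_sum,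
      map_list_prod, List.map_ofFn, Function.comp_def, DefEnv.map_ι]
  exact LinearMap.congr_fun this s

theorem FPBW_bijective {V : Type*} [AddCommGroup V] [Module ℂ V] {t : ℂ}
    (h : Function.Bijective (IPBW L t)) : Function.Bijective (FPBW L V t) :=
  (TensorProduct.congr (LinearEquiv.refl ℂ (Module.End ℂ V))
    (LinearEquiv.ofBijective (IPBW L t) h)).bijective

variable {E : Type*} [NormedAddCommGroup E] [NormedSpace ℂ E] [CompleteSpace E]
  {G : Type*} [TopologicalSpace G] [ChartedSpace E G] [Group G] [LieGroup 𝓘(ℂ, E) ω G]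
  (e : GroupLieAlgebra 𝓘(ℂ, E) G ≃ₗ⁅ℂ⁆ L) {V : Type*} [AddCommGroup V] [Module ℂ V]

theorem FPBW_classicalAct (T : Representation ℂ G V) (t : ℂ) (g : G)
    (z : Module.End ℂ V ⊗[ℂ] SymmetricAlgebra ℂ L) :
    FPBW L V t (classicalAct e T g z) = quantumAct e T t g (FPBW L V t z) := by
  induction z with
  | zero => simp
  | add y z hy hz => simp only [map_add, hy, hz]
  | tmul A s => simp [FPBW, classicalAct, quantumAct, IPBW_symMap]

theorem FPBW_mem_quantumFamilyAlgebra_iff (T : Representation ℂ G V) {t : ℂ}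
    (h : Function.Bijective (IPBW L t)) (z : Module.End ℂ V ⊗[ℂ] SymmetricAlgebra ℂ L) :
    FPBW L V t z ∈ quantumFamilyAlgebra e T t ↔ z ∈ classicalFamilyAlgebra e T :=
  forall_congr' fun g => by
    rw [← FPBW_classicalAct, (FPBW_bijective h).injective.eq_iff]

end Equivariance

/-! ### Vector fields acting on analytic functions -/

section VectorFields

variable {E : Type*} [NormedAddCommGroup E] [NormedSpace ℂ E]

/-- The functions on `E` that are analytic on `U`. -/
def analyticFunctions (U : Set E) : Subalgebra ℂ (E → ℂ) where
  carrier := {f | ContDiffOn ℂ ω f U}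
  mul_mem' hf hg := ContDiffOn.mul hf hg
  add_mem' hf hg := ContDiffOn.add hf hg
  algebraMap_mem' _ := contDiffOn_const

variable {U : Set E}

theorem contDiffOn_fderiv_apply (hU : IsOpen U) {f : E → ℂ} {W : E → E} (hf : ContDiffOn ℂ ω f U)
    (hW : ContDiffOn ℂ ω W U) : ContDiffOn ℂ ω (fun y => fderiv ℂ f y (W y)) U :=
  (hf.fderiv_of_isOpen hU (by simp)).clm_apply hW

open Classical in
/-- The derivation of the algebra of functions analytic on `U` given by a vector field `W`; its
values vanish outside `U`. -/
def vectorFieldDerivation (hU : IsOpen U) (W : E → E) (hW : ContDiffOn ℂ ω W U) :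
    Derivation ℂ (analyticFunctions U) (analyticFunctions U) :=
  Derivation.mk'
    -- Elements of the algebra are arbitrary off `U`, yet equality is tested on all of `E`; the
    -- value zero makes the derivation identities hold there too.
    { toFun := fun f => ⟨fun y => if y ∈ U then fderiv ℂ (f : E → ℂ) y (W y) else 0,
        (contDiffOn_fderiv_apply hU f.2 hW).congr fun y hy => if_pos hy⟩
      map_add' := fun f g => by
        ext y
        by_cases hy : y ∈ U
        · have hf := (f.2.contDiffAt (hU.mem_nhds hy)).differentiableAt (by simp)
          have hg := (g.2.contDiffAt (hU.mem_nhds hy)).differentiableAt (by simp)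
          simp [hy, fderiv_add hf hg]
        · simp [hy]
      map_smul' := fun c f => by
        ext y
        by_cases hy : y ∈ U
        · have hf := (f.2.contDiffAt (hU.mem_nhds hy)).differentiableAt (by simp)
          simp [hy, fderiv_const_smul hf]
        · simp [hy] }
    fun f g => by
      ext y
      by_cases hy : y ∈ U
      · have hf := (f.2.contDiffAt (hU.mem_nhds hy)).differentiableAt (by simp)
        have hg := (g.2.contDiffAt (hU.mem_nhds hy)).differentiableAt (by simp)
        simp [hy, fderiv_mul hf hg]
      · simp [hy]

theorem vectorFieldDerivation_apply (hU : IsOpen U) {W : E → E} (hW : ContDiffOn ℂ ω W U)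
    (f : analyticFunctions U) {y : E} (hy : y ∈ U) :
    (vectorFieldDerivation hU W hW f : E → ℂ) y = fderiv ℂ (f : E → ℂ) y (W y) :=
  if_pos hy

theorem vectorFieldDerivation_apply_of_notMem (hU : IsOpen U) {W : E → E}
    (hW : ContDiffOn ℂ ω W U) (f : analyticFunctions U) {y : E} (hy : y ∉ U) :
    (vectorFieldDerivation hU W hW f : E → ℂ) y = 0 :=
  if_neg hy

theorem vectorFieldDerivation_commutator (hU : IsOpen U) {W₁ W₂ W : E → E}
    (h₁ : ContDiffOn ℂ ω W₁ U) (h₂ : ContDiffOn ℂ ω W₂ U) (hW : ContDiffOn ℂ ω W U)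
    (h : ∀ y ∈ U, VectorField.lieBracket ℂ W₁ W₂ y = W y) (f : analyticFunctions U) :
    vectorFieldDerivation hU W₁ h₁ (vectorFieldDerivation hU W₂ h₂ f) -
      vectorFieldDerivation hU W₂ h₂ (vectorFieldDerivation hU W₁ h₁ f) =
        vectorFieldDerivation hU W hW f := by
  ext y
  by_cases hy : y ∈ U
  · have hU' := hU.mem_nhds hy
    have e {W' : E → E} (h' : ContDiffOn ℂ ω W' U) :
        fderiv ℂ (vectorFieldDerivation hU W' h' f : E → ℂ) y =
          fderiv ℂ (fun z => fderiv ℂ (f : E → ℂ) z (W' z)) y :=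
      Filter.EventuallyEq.fderiv_eq (by
        filter_upwards [hU'] with z hz using vectorFieldDerivation_apply hU h' f hz)
    have := VectorField.fderiv_apply_lieBracket (f.2.contDiffAt hU') le_top
      ((h₂.contDiffAt hU').differentiableAt (by simp))
      ((h₁.contDiffAt hU').differentiableAt (by simp))
    simp only [AddSubgroupClass.coe_sub, Pi.sub_apply, vectorFieldDerivation_apply hU _ _ hy, e]
    rw [← h y hy, this]
  · simp [vectorFieldDerivation_apply_of_notMem, hy]

variable {L : Type*} [LieRing L] [LieAlgebra ℂ L]

theorem IPBW_injective_of_vectorFields [FiniteDimensional ℂ E] (hU : IsOpen U) (W : L →ₗ[ℂ] E → E)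
    (hW : ∀ X, ContDiffOn ℂ ω (W X) U)
    (hbr : ∀ X Y, ∀ y ∈ U, VectorField.lieBracket ℂ (W X) (W Y) y = W ⁅X, Y⁆ y)
    {y₀ : E} (hy₀ : y₀ ∈ U) (hinj : ∀ X, W X y₀ = 0 → X = 0) {t : ℂ} (ht : t ≠ 0) :
    Function.Injective (IPBW L t) := by
  let W₀ : L →ₗ[ℂ] E := LinearMap.proj y₀ ∘ₗ W
  have hker : LinearMap.ker W₀ = ⊥ := (LinearMap.ker_eq_bot' ).2 hinj
  have : FiniteDimensional ℂ L := FiniteDimensional.of_injective W₀ (LinearMap.ker_eq_bot.1 hker)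
  -- Composed with the coordinates of `b`, this left inverse gives linear functions on `E` dual to
  -- the vectors `W (b i) y₀`.
  obtain ⟨p, hp⟩ := W₀.exists_leftInverse_of_injective hker
  let b := Module.finBasis ℂ L
  let D : L →ₗ[ℂ] Derivation ℂ (analyticFunctions U) (analyticFunctions U) :=
    -- The factor `t` turns the bracket relation into that of `U_t(L)`: `[tW X, tW Y] = t • (tW ⁅X,
    -- Y⁆)`. The factor `t⁻¹` in the coordinates `x` below compensates for it, which is where `t ≠
    -- 0` enters.
    { toFun := fun X => t • vectorFieldDerivation hU (W X) (hW X)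
      map_add' := fun X Y => by
        ext f y
        by_cases hy : y ∈ U
        · simp [vectorFieldDerivation_apply, hy, mul_add]
        · simp [vectorFieldDerivation_apply_of_notMem, hy]
      map_smul' := fun c X => by
        ext f y
        by_cases hy : y ∈ U
        · simp [vectorFieldDerivation_apply, hy, mul_left_comm]
        · simp [vectorFieldDerivation_apply_of_notMem, hy] }
  let φ (j) : E →L[ℂ] ℂ := LinearMap.toContinuousLinearMap (b.coord j ∘ₗ p)
  let x (j) : analyticFunctions U :=
    ⟨fun y => t⁻¹ * φ j (y - y₀), by
      refine ContDiff.contDiffOn ?_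
      fun_prop⟩
  let ev : analyticFunctions U →ₐ[ℂ] ℂ := (Pi.evalAlgHom ℂ (fun _ : E => ℂ) y₀).comp
    (analyticFunctions U).val
  refine IPBW_injective_of_derivations (D := D) (b := b) (x := x) (ev := ev) (fun X Y f => ?_)
    (fun i => by simp [ev, x]) fun i j => ?_
  · have := vectorFieldDerivation_commutator hU (hW X) (hW Y) (hW ⁅X, Y⁆) (hbr X Y) f
    simp only [D, LinearMap.coe_mk, AddHom.coe_mk, Derivation.smul_apply, ← this,
      Derivation.map_smul, smul_sub]
  · have hd : HasFDerivAt (fun y => t⁻¹ * φ j (y - y₀)) (t⁻¹ • φ j) y₀ :=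
      (((φ j).hasFDerivAt).comp y₀ ((hasFDerivAt_id y₀).sub_const y₀)).const_mul t⁻¹
    have hpi : p (W (b i) y₀) = b i := LinearMap.congr_fun hp (b i)
    have : ev (D (b i) (x j)) = t * fderiv ℂ (fun y => t⁻¹ * φ j (y - y₀)) y₀ (W (b i) y₀) := by
      simp [ev, D, x, vectorFieldDerivation_apply, hy₀]
    rw [this, hd.fderiv]
    simp [φ, hpi, ht, Finsupp.single_apply]

end VectorFields

/-! ### Left invariant vector fields in the chart at the identity -/

section InvariantVectorFields

variable {E : Type*} [NormedAddCommGroup E] [NormedSpace ℂ E]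
  {G : Type*} [TopologicalSpace G] [ChartedSpace E G] [Group G] [LieGroup 𝓘(ℂ, E) ω G]

/-- The field is `g ↦ dμ (0_g, v)` for the multiplication `μ`, a composite of analytic maps. -/
theorem contMDiff_mulInvariantVectorField_analytic (v : GroupLieAlgebra 𝓘(ℂ, E) G) :
    ContMDiff 𝓘(ℂ, E) 𝓘(ℂ, E).tangent ω
      (fun g : G => (mulInvariantVectorField v g : TangentBundle 𝓘(ℂ, E) G)) := by
  let I := 𝓘(ℂ, E)
  have sfg : ContMDiff I I.tangent ω
      (fun g => Bundle.TotalSpace.mk' E g 0 : G → TangentBundle I G) :=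
    Bundle.contMDiff_zeroSection _ _
  have sfv : ContMDiff I I.tangent ω
      (fun _ => Bundle.TotalSpace.mk' E 1 v : G → TangentBundle I G) := contMDiff_const
  have S₁ := sfg.prodMk sfv
  have S₂ : ContMDiff (I.tangent.prod I.tangent) (I.prod I).tangent ω
      (equivTangentBundleProd I G I G).symm := contMDiff_equivTangentBundleProd_symm
  have S₃ : ContMDiff (I.prod I).tangent I.tangent ω
      (tangentMap (I.prod I) I (fun p : G × G => p.1 * p.2)) :=
    ContMDiff.contMDiff_tangentMap (n := ω) (contMDiff_mul I ω) (by simp)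
  refine ((S₃.comp S₂).comp S₁).congr fun g => ?_
  have hd : mfderiv (I.prod I) I (fun p : G × G => p.1 * p.2) (g, 1) (0, v) =
      mfderiv I I (fun z : G => g * z) 1 v := by
    refine (mfderiv_prod_eq_add_apply
      ((contMDiff_mul I ω).mdifferentiableAt (x := ((g, 1) : G × G)) (by simp))).trans ?_
    exact (congrArg (· + mfderiv I I (fun z : G => g * z) 1 v)
      (ContinuousLinearMap.map_zero _)).trans (zero_add _)
  exact Bundle.TotalSpace.ext (mul_one g).symm (heq_of_eq hd.symm)

variable (E G) in
/-- The domain of the chart of `G` at `1`, as a subset of the model space. -/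
def chartDomain : Set E := (extChartAt 𝓘(ℂ, E) (1 : G)).target

theorem isOpen_chartDomain {G : Type*} [TopologicalSpace G] [ChartedSpace E G] [Group G] :
    IsOpen (chartDomain E G) := isOpen_extChartAt_target _

/-- The left invariant vector field of `v` in the chart of `G` at `1`. -/
def chartVectorField (v : GroupLieAlgebra 𝓘(ℂ, E) G) : E → E :=
  VectorField.mpullback 𝓘(ℂ, E) 𝓘(ℂ, E) (extChartAt 𝓘(ℂ, E) (1 : G)).symm
    (mulInvariantVectorField v)

theorem contMDiffAt_chart_symm {y : E} (hy : y ∈ chartDomain E G) :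
    ContMDiffAt 𝓘(ℂ, E) 𝓘(ℂ, E) ω (extChartAt 𝓘(ℂ, E) (1 : G)).symm y :=
  have : IsManifold 𝓘(ℂ, E) ω G := ‹LieGroup 𝓘(ℂ, E) ω G›.toContMDiffMul.toIsManifold
  (contMDiffOn_extChartAt_symm (1 : G)).contMDiffAt (isOpen_chartDomain.mem_nhds hy)

theorem isInvertible_mfderiv_chart_symm {y : E} (hy : y ∈ chartDomain E G) :
    (mfderiv 𝓘(ℂ, E) 𝓘(ℂ, E) (extChartAt 𝓘(ℂ, E) (1 : G)).symm y).IsInvertible := by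
  have := isInvertible_mfderivWithin_extChartAt_symm (I := 𝓘(ℂ, E)) hy
  rwa [modelWithCornersSelf_coe, Set.range_id, mfderivWithin_univ] at this

theorem contDiffOn_chartVectorField [CompleteSpace E] (v : GroupLieAlgebra 𝓘(ℂ, E) G) :
    ContDiffOn ℂ ω (chartVectorField v) (chartDomain E G) := by
  intro y hy
  have h := ContMDiffAt.mpullback_vectorField_preimage (m := ω) (n := ω)
    (contMDiff_mulInvariantVectorField_analytic v).contMDiffAt (contMDiffAt_chart_symm hy)
    (isInvertible_mfderiv_chart_symm hy) (by simp)
  have := ((contMDiff_snd_tangentBundle_modelSpace E 𝓘(ℂ, E)).contMDiffAt.comp y h).contDiffAt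
  exact this.contDiffWithinAt

/-- Pullback along the inverse chart respects brackets, and the bracket on the Lie algebra of `G` is
that of left invariant fields. -/
theorem lieBracket_chartVectorField [CompleteSpace E] (v w : GroupLieAlgebra 𝓘(ℂ, E) G) {y : E}
    (hy : y ∈ chartDomain E G) :
    VectorField.lieBracket ℂ (chartVectorField v) (chartVectorField w) y =
      chartVectorField ⁅v, w⁆ y := by
  have h := VectorField.mpullback_mlieBracket (n := ω)
    (mdifferentiableAt_mulInvariantVectorField v) (mdifferentiableAt_mulInvariantVectorField w)
    (contMDiffAt_chart_symm (G := G) hy) le_top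
  rw [← mulInvariantVector_mlieBracket, ← VectorField.mlieBracketWithin_univ (I := 𝓘(ℂ, E))
    (M := E), VectorField.mlieBracketWithin_eq_lieBracketWithin] at h
  rw [← VectorField.lieBracketWithin_univ]
  exact h.symm

variable (E G) in
/-- `chartVectorField` as a linear map. -/
def chartVectorFieldₗ : GroupLieAlgebra 𝓘(ℂ, E) G →ₗ[ℂ] E → E where
  toFun := chartVectorField
  map_add' v w := by
    have : IsManifold 𝓘(ℂ, E) ω G := ‹LieGroup 𝓘(ℂ, E) ω G›.toContMDiffMul.toIsManifold
    rw [chartVectorField, mulInvariantVectorField_add, VectorField.mpullback_add]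
    rfl
  map_smul' c v := by
    rw [chartVectorField, mulInvariantVectorField_smul, VectorField.mpullback_const_smul]
    rfl

/-- The invariant field takes the value `v` at `1`, and the derivative of the inverse chart is
invertible. -/
theorem eq_zero_of_chartVectorField_eq_zero {v : GroupLieAlgebra 𝓘(ℂ, E) G}
    (h : chartVectorField v (extChartAt 𝓘(ℂ, E) (1 : G) 1) = 0) : v = 0 := by
  have hy := mem_extChartAt_target (I := 𝓘(ℂ, E)) (1 : G)
  have := (isInvertible_mfderiv_chart_symm hy).inverse_apply_eq.1 h
  rw [extChartAt_to_inv] at this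
  have e : mulInvariantVectorField v (1 : G) = v := by
    have : (fun g : G => 1 * g) = id := funext one_mul
    rw [mulInvariantVectorField, this]
    exact DFunLike.congr_fun (mfderiv_id (I := 𝓘(ℂ, E)) (x := (1 : G))) v
  exact e.symm.trans (this.trans
    (map_zero (mfderiv 𝓘(ℂ, E) 𝓘(ℂ, E) (extChartAt 𝓘(ℂ, E) (1 : G)).symm
      (extChartAt 𝓘(ℂ, E) (1 : G) 1) : E →L[ℂ] E)))

theorem IPBW_bijective [FiniteDimensional ℂ E] [CompleteSpace E] {L : Type*} [LieRing L]
    [LieAlgebra ℂ L] (e : GroupLieAlgebra 𝓘(ℂ, E) G ≃ₗ⁅ℂ⁆ L) (t : ℂ) :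
    Function.Bijective (IPBW L t) := by
  refine ⟨?_, IPBW_surjective t⟩
  rcases eq_or_ne t 0 with rfl | ht
  · exact IPBW_zero_injective L
  · refine IPBW_injective_of_vectorFields (isOpen_chartDomain (E := E) (G := G))
      (chartVectorFieldₗ E G ∘ₗ (e.symm : L →ₗ[ℂ] GroupLieAlgebra 𝓘(ℂ, E) G))
      (fun X => contDiffOn_chartVectorField _) (fun X Y y hy => ?_)
      (mem_extChartAt_target (1 : G)) (fun X hX => ?_) ht
    · refine (lieBracket_chartVectorField (e.symm X) (e.symm Y) hy).trans ?_
      rw [← LieEquiv.map_lie]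
      rfl
    · simpa using congrArg e (eq_zero_of_chartVectorField_eq_zero hX)

end InvariantVectorFields

end FamilyAlgebra

end

theorem proposition4p7
    {E : Type*} [NormedAddCommGroup E] [NormedSpace ℂ E] [FiniteDimensional ℂ E] [CompleteSpace E]
    {G : Type*} [TopologicalSpace G] [ChartedSpace E G] [Group G] [LieGroup 𝓘(ℂ, E) ω G]
    [SimplyConnectedSpace G]
    {𝔤 : Type*} [LieRing 𝔤] [LieAlgebra ℂ 𝔤] (e : GroupLieAlgebra 𝓘(ℂ, E) G ≃ₗ⁅ℂ⁆ 𝔤)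
    {V : Type*} [AddCommGroup V] [Module ℂ V] [FiniteDimensional ℂ V]
    [LieRingModule 𝔤 V] [LieModule ℂ 𝔤 V]
    (T : Representation ℂ G V) (hT : FamilyAlgebra.Integrates e T) (t : ℂ) :
    (Subalgebra.toSubmodule (FamilyAlgebra.classicalFamilyAlgebra e T)).map
        (FamilyAlgebra.FPBW 𝔤 V t) =
      Subalgebra.toSubmodule (FamilyAlgebra.quantumFamilyAlgebra e T t) ∧
    ∃ Φ : FamilyAlgebra.classicalFamilyAlgebra e T ≃ₗ[ℂ] FamilyAlgebra.quantumFamilyAlgebra e T t,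
      ∀ x : FamilyAlgebra.classicalFamilyAlgebra e T,
        (Φ x : Module.End ℂ V ⊗[ℂ] FamilyAlgebra.DefEnv 𝔤 t) = FamilyAlgebra.FPBW 𝔤 V t x := by
  have h := FamilyAlgebra.IPBW_bijective e t
  have hmem := FamilyAlgebra.FPBW_mem_quantumFamilyAlgebra_iff e T h
  have himage : (Subalgebra.toSubmodule (FamilyAlgebra.classicalFamilyAlgebra e T)).map
      (FamilyAlgebra.FPBW 𝔤 V t) =
        Subalgebra.toSubmodule (FamilyAlgebra.quantumFamilyAlgebra e T t) := by
    ext w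
    obtain ⟨z, rfl⟩ := (FamilyAlgebra.FPBW_bijective (V := V) h).surjective w
    rw [Submodule.mem_map]
    refine ⟨?_, fun hz => ⟨z, (hmem z).1 hz, rfl⟩⟩
    rintro ⟨y, hy, hyz⟩
    exact hyz ▸ (hmem y).2 hy
  exact ⟨himage, (LinearEquiv.ofBijective _ (FamilyAlgebra.FPBW_bijective (V := V) h)).ofSubmodules
    _ _ himage, fun _ => rfl⟩
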